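/- Let $S$ be a connected graph, regarded as the set of its vertices with the graph distance $d$. For $l\in\mathbb N=\{0,1,2,\dots\}$, a geodesic path of length $l$ in $S$ is a map $\alpha:\{0,\dots,l\}\to S$ with $d(\alpha(i),\alpha(j))\le|i-j|$ for all $i,j$ and $d(\alpha(0),\alpha(l))=l$. A bigon $\beta=\{\alpha,\alpha'\}$ of length $|\beta|=l$ is a pair of distinct geodesic paths of the same length $l$ such that $d(\alpha(0),\alpha'(0))+d(\alpha(l),\alpha'(l))\le 1$; its width function is $w_\beta(i)=d(\alpha(i),\alpha'(i))$ for $0\le i\le l$. Suppose that the bigons of $S$ are thin almost surely (TAS): for every real $\varepsilon>0$ there exists $x\in\mathbb N$ such that, for every bigon $\beta$ in $S$, $$\#\{i\in\{0,\dots,|\beta|\}: w_\beta(i)>x\}\le\varepsilon\cdot|\beta|.$$ Then $S$ is Gromov hyperbolic: there exists $\delta\ge 0$ such that $(x|z)_w\ge\min\{(x|y)_w,(y|z)_w\}-\delta$ for all vertices $w,x,y,z$ of $S$, where $(x|y)_w=\tfrac12\bigl(d(x,w)+d(y,w)-d(x,y)\bigr)$. -/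

import Mathlib

namespace SimpleGraph

variable {V : Type*} (G : SimpleGraph V)

/-- `α` restricted to `{0, …, l}` is a path of length `l` in `G`, that is, a distance
non-increasing map `{0, …, l} → V`. The values of `α` beyond `l` play no role. -/
def IsDiscretePath (l : ℕ) (α : ℕ → V) : Prop :=
  ∀ i ≤ l, ∀ j ≤ l, G.dist (α i) (α j) ≤ Nat.dist i j

/-- `α` restricted to `{0, …, l}` is a geodesic path of length `l` in `G`. -/
def IsGeodesicPath (l : ℕ) (α : ℕ → V) : Prop :=
  G.IsDiscretePath l α ∧ G.dist (α 0) (α l) = l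

/-- The distance between two distinct geodesic paths `α` and `α'` of lengths `l` and `l'`. -/
noncomputable def geodesicPathDist (l : ℕ) (α : ℕ → V) (l' : ℕ) (α' : ℕ → V) : ℕ :=
  max 1 (G.dist (α 0) (α' 0) + G.dist (α l) (α' l'))

/-- A (geodesic) bigon of length `l`: two distinct geodesic paths of the same length `l`
which are at distance `1` from each other. -/
def IsBigon (l : ℕ) (α α' : ℕ → V) : Prop :=
  G.IsGeodesicPath l α ∧ G.IsGeodesicPath l α' ∧ (∃ i ≤ l, α i ≠ α' i) ∧
    G.geodesicPathDist l α l α' = 1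

/-- The width of the pair `α, α'` at the index `i`. -/
noncomputable def bigonWidth (α α' : ℕ → V) (i : ℕ) : ℕ :=
  G.dist (α i) (α' i)

/-- The bigons of `G` are thin almost surely. -/
def ThinAlmostSurely : Prop :=
  ∀ ε : ℝ, 0 < ε → ∃ x : ℕ, ∀ (l : ℕ) (α α' : ℕ → V), G.IsBigon l α α' →
    (((Finset.range (l + 1)).filter (fun i => x < G.bigonWidth α α' i)).card : ℝ) ≤ ε * (l : ℝ)

/-- The Gromov product `(x | y)_w` for the graph distance. -/
noncomputable def gromovProduct (w x y : V) : ℝ :=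
  ((G.dist x w : ℝ) + (G.dist y w : ℝ) - (G.dist x y : ℝ)) / 2

/-- Gromov hyperbolicity of the vertex set of `G` with the graph distance. -/
def IsGromovHyperbolic : Prop :=
  ∃ δ : ℝ, 0 ≤ δ ∧ ∀ w x y z : V,
    min (G.gromovProduct w x y) (G.gromovProduct w y z) - δ ≤ G.gromovProduct w x z

end SimpleGraph

namespace SimpleGraph

variable {V : Type*} {G : SimpleGraph V}

/-! For geodesics α, β with a common origin, the excess d(α s, β t) - (t - s) is nonnegative and can
only decrease as [s, t] grows. If d(α t, β t) ≤ Y at more than half of the times of a long window, a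
pigeonhole over triadic subdivisions (`exists_stable_interval`) gives an interval whose outer thirds
have the same excess as the whole. Crossing from α to β during the first third or during the last
one then gives two geodesics with the same ends, and thinness of this bigon makes α and β 2x-close
at some time (`exists_dist_le_two_mul`). The gain is that x does not depend on Y.

This gives uniform thinness of bigons, by cutting between close times until the gaps are bounded,
and then a contraction: distance 2K at time t + L forces distance K at time t. Chains of geodesics
thus halve over each L steps back to the origin, so moving the end of a geodesic of length l by N
displaces its point at time s boundedly when s + N ≤ l. Hence geodesics from one origin
fellow-travel up to the Gromov product of their ends, which is hyperbolicity. -/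

/-! ### Geodesic paths in a graph -/

theorem IsGeodesicPath.dist_eq (hG : G.Connected) {l : ℕ} {α : ℕ → V}
    (h : G.IsGeodesicPath l α) {i j : ℕ} (hij : i ≤ j) (hj : j ≤ l) :
    G.dist (α i) (α j) = j - i := by
  obtain ⟨h1, h2⟩ := h
  have e1 := h1 0 (by omega) i (by omega)
  have e2 := h1 i (by omega) j hj
  have e3 := h1 j hj l le_rfl
  have t1 := hG.dist_triangle (u := α 0) (v := α i) (w := α l)
  have t2 := hG.dist_triangle (u := α i) (v := α j) (w := α l)
  simp only [Nat.dist] at e1 e2 e3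
  omega

theorem dist_le_of_dist_succ_le (hG : G.Connected) {l : ℕ} {α : ℕ → V}
    (h : ∀ i < l, G.dist (α i) (α (i + 1)) ≤ 1) (i n : ℕ) (hn : i + n ≤ l) :
    G.dist (α i) (α (i + n)) ≤ n := by
  induction n with
  | zero => simp
  | succ n ih =>
    have := ih (by omega)
    have h' := h (i + n) (by omega)
    have t := hG.dist_triangle (u := α i) (v := α (i + n)) (w := α (i + n + 1))
    rw [← add_assoc]
    omega

theorem isGeodesicPath_of_dist_succ_le (hG : G.Connected) {l : ℕ} {α : ℕ → V}
    (h : ∀ i < l, G.dist (α i) (α (i + 1)) ≤ 1) (h' : l ≤ G.dist (α 0) (α l)) :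
    G.IsGeodesicPath l α := by
  have key : ∀ i j, i ≤ j → j ≤ l → G.dist (α i) (α j) ≤ j - i := by
    intro i j hij hj
    obtain ⟨n, rfl⟩ := Nat.exists_eq_add_of_le hij
    have := dist_le_of_dist_succ_le hG h i n hj
    omega
  refine ⟨fun i hi j hj => ?_, le_antisymm (key 0 l (by omega) le_rfl) h'⟩
  rcases le_total i j with hij | hij
  · have := key i j hij hj
    simp only [Nat.dist]; omega
  · have := key j i hij hi
    rw [dist_comm]
    simp only [Nat.dist]; omega

theorem IsGeodesicPath.mono (hG : G.Connected) {l m : ℕ} {α : ℕ → V}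
    (h : G.IsGeodesicPath l α) (hm : m ≤ l) : G.IsGeodesicPath m α :=
  ⟨fun i hi j hj => h.1 i (hi.trans hm) j (hj.trans hm),
    by have := h.dist_eq hG (Nat.zero_le m) hm; omega⟩

theorem IsGeodesicPath.shift (hG : G.Connected) {l m a : ℕ} {α : ℕ → V}
    (h : G.IsGeodesicPath l α) (hm : a + m ≤ l) :
    G.IsGeodesicPath m (fun t => α (a + t)) := by
  refine isGeodesicPath_of_dist_succ_le hG (fun i hi => ?_) ?_
  · rw [h.dist_eq hG (by omega) (by omega)]; omega
  · rw [h.dist_eq hG (by omega) (by omega)]; omega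

theorem IsGeodesicPath.reverse (hG : G.Connected) {l : ℕ} {α : ℕ → V}
    (h : G.IsGeodesicPath l α) : G.IsGeodesicPath l (fun t => α (l - t)) := by
  refine isGeodesicPath_of_dist_succ_le hG (fun i hi => ?_) ?_
  · rw [dist_comm, h.dist_eq hG (by omega) (by omega)]; omega
  · rw [dist_comm, h.dist_eq hG (by omega) (by omega)]; omega

theorem IsGeodesicPath.concat (hG : G.Connected) {l m : ℕ} {α β : ℕ → V}
    (hα : G.IsGeodesicPath l α) (hβ : G.IsGeodesicPath m β) (hαβ : α l = β 0)
    (hd : l + m ≤ G.dist (α 0) (β m)) :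
    G.IsGeodesicPath (l + m) (fun t => if t ≤ l then α t else β (t - l)) := by
  refine isGeodesicPath_of_dist_succ_le hG (fun i hi => ?_) ?_
  · split_ifs with h1 h2
    · rw [hα.dist_eq hG (by omega) (by omega)]; omega
    · obtain rfl : i = l := by omega
      rw [hαβ, hβ.dist_eq hG (by omega) (by omega)]; omega
    · omega
    · rw [hβ.dist_eq hG (by omega) (by omega)]; omega
  · rw [if_pos (Nat.zero_le _)]
    split_ifs with h1
    · obtain rfl : m = 0 := by omega
      simpa [hαβ] using hd
    · simpa using hd

theorem exists_isGeodesicPath (hG : G.Connected) (u v : V) :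
    ∃ α : ℕ → V, G.IsGeodesicPath (G.dist u v) α ∧ α 0 = u ∧ α (G.dist u v) = v := by
  obtain ⟨p, hp⟩ := hG.exists_walk_length_eq_dist u v
  refine ⟨p.getVert, isGeodesicPath_of_dist_succ_le hG (fun i hi => ?_) ?_, by simp, ?_⟩
  · exact (dist_eq_one_iff_adj.2 (p.adj_getVert_succ (by omega))).le
  · rw [← hp, p.getVert_zero, p.getVert_length, hp]
  · rw [← hp]; simp

theorem exists_dist_le_dist_le (hG : G.Connected) {u v : V} {a b : ℕ}
    (h : G.dist u v ≤ a + b) : ∃ p, G.dist u p ≤ a ∧ G.dist p v ≤ b := by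
  obtain ⟨α, hα, h0, h1⟩ := exists_isGeodesicPath hG u v
  refine ⟨α (min a (G.dist u v)), ?_, ?_⟩
  · have := hα.dist_eq hG (Nat.zero_le (min a (G.dist u v))) (min_le_right _ _)
    rw [h0] at this
    omega
  · have := hα.dist_eq hG (min_le_right a (G.dist u v)) le_rfl
    rw [h1] at this
    omega

/-- Two geodesics with the same origin diverge with speed at most two. -/
theorem IsGeodesicPath.dist_le_add (hG : G.Connected) {l : ℕ} {α β : ℕ → V}
    (hα : G.IsGeodesicPath l α) (hβ : G.IsGeodesicPath l β) {i j : ℕ} (hi : i ≤ l) (hj : j ≤ l) :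
    G.dist (α j) (β j) ≤ G.dist (α i) (β i) + 2 * Nat.dist i j := by
  have h1 := hα.1 j hj i hi
  have h2 := hβ.1 i hi j hj
  have t1 := hG.dist_triangle (u := α j) (v := α i) (w := β j)
  have t2 := hG.dist_triangle (u := α i) (v := β i) (w := β j)
  rw [Nat.dist_comm] at h1
  omega

/-! ### Thinness for nearby ends -/

/-- Almost sure thinness at the scale `ε` with constant `x`, without the requirement that the
geodesics be distinct. -/
theorem ThinAlmostSurely.exists_card_le (hT : G.ThinAlmostSurely) {ε : ℝ} (hε : 0 < ε) :
    ∃ x : ℕ, ∀ (l : ℕ) (α β : ℕ → V), G.IsGeodesicPath l α → G.IsGeodesicPath l β →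
      G.dist (α 0) (β 0) + G.dist (α l) (β l) ≤ 1 →
      (((Finset.range (l + 1)).filter (fun i => x < G.dist (α i) (β i))).card : ℝ) ≤ ε * l := by
  obtain ⟨x, hx⟩ := hT ε hε
  refine ⟨x, fun l α β hα hβ h => ?_⟩
  by_cases hne : ∃ i ≤ l, α i ≠ β i
  · exact hx l α β ⟨hα, hβ, hne, by simp only [geodesicPathDist]; omega⟩
  · push Not at hne
    have : (Finset.range (l + 1)).filter (fun i => x < G.dist (α i) (β i)) = ∅ := by
      refine Finset.filter_eq_empty_iff.2 fun i hi => ?_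
      rw [hne i (by simpa [Nat.lt_succ_iff] using hi)]
      simp
    rw [this]
    simp only [Finset.card_empty, Nat.cast_zero]
    positivity

theorem card_filter_range_mono {p q : ℕ → Prop} [DecidablePred p] [DecidablePred q] {m n : ℕ}
    (hmn : m ≤ n) (h : ∀ i < m, p i → q i) :
    ((Finset.range m).filter p).card ≤ ((Finset.range n).filter q).card := by
  refine Finset.card_le_card fun i hi => ?_
  simp only [Finset.mem_filter, Finset.mem_range] at hi ⊢
  exact ⟨by omega, h i hi.1 hi.2⟩

/-- If the lengths differ, they differ by one, and the shorter path followed by the end of the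
longer one is again a geodesic. -/
theorem exists_card_le_of_dist_le_one (hG : G.Connected) {ε : ℝ} (hε : 0 < ε) {x : ℕ}
    (hx : ∀ (l : ℕ) (α β : ℕ → V), G.IsGeodesicPath l α → G.IsGeodesicPath l β →
      G.dist (α 0) (β 0) + G.dist (α l) (β l) ≤ 1 →
      (((Finset.range (l + 1)).filter (fun i => x < G.dist (α i) (β i))).card : ℝ) ≤ ε * l)
    {l l' T : ℕ} {α β : ℕ → V} (hα : G.IsGeodesicPath l α) (hβ : G.IsGeodesicPath l' β)
    (h0 : α 0 = β 0) (h1 : G.dist (α l) (β l') ≤ 1) (hT : T ≤ l) (hT' : T ≤ l') :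
    (((Finset.range (T + 1)).filter (fun i => x < G.dist (α i) (β i))).card : ℝ)
      ≤ ε * (l + 1) := by
  have main : ∀ {l l' : ℕ} {α β : ℕ → V}, G.IsGeodesicPath l α → G.IsGeodesicPath l' β →
      α 0 = β 0 → G.dist (α l) (β l') ≤ 1 → T ≤ l → l ≤ l' →
      (((Finset.range (T + 1)).filter (fun i => x < G.dist (α i) (β i))).card : ℝ)
        ≤ ε * l' := by
    intro l l' α β hα hβ h0 h1 hT hl
    have e1 : G.dist (α 0) (β l') = l' := h0 ▸ hβ.2
    have e2 := hα.2
    have t := hG.dist_triangle (u := α 0) (v := α l) (w := β l')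
    rcases (show l' = l ∨ l' = l + 1 by omega) with rfl | rfl
    · refine le_trans ?_ (hx l' α β hα hβ (by simpa [h0] using h1))
      exact_mod_cast card_filter_range_mono (by omega) fun _ _ h => h
    · have hγ : G.IsGeodesicPath (l + 1) (fun t => if t ≤ l then α t else β (l + 1)) := by
        refine isGeodesicPath_of_dist_succ_le hG (fun i hi => ?_) (by simp [e1])
        split_ifs with a1 a2
        · rw [hα.dist_eq hG (by omega) (by omega)]; omega
        · obtain rfl : i = l := by omega
          exact h1
        · omega
        · omega
      refine le_trans ?_ (hx (l + 1) _ β hγ hβ (by simp [h0]))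
      refine Nat.cast_le.2 (card_filter_range_mono (by omega) fun i hi h => ?_)
      rwa [if_pos (by omega)]
  rcases le_total l l' with hl | hl
  · have := main hα hβ h0 h1 hT hl
    have e1 : G.dist (α 0) (β l') = l' := h0 ▸ hβ.2
    have t := hG.dist_triangle (u := α 0) (v := α l) (w := β l')
    rw [hα.2, e1] at t
    have : (l' : ℝ) ≤ l + 1 := by exact_mod_cast (by omega : l' ≤ l + 1)
    nlinarith
  · have := main hβ hα h0.symm (by rwa [dist_comm]) hT' hl
    simp only [dist_comm (G := G) (u := β _)] at this
    linarith

/-- Almost sure thinness for pairs of geodesics with a common origin and nearby ends. -/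
theorem exists_card_le_of_dist_le (hG : G.Connected) {ε : ℝ} (hε : 0 < ε) {x : ℕ}
    (hx : ∀ (l : ℕ) (α β : ℕ → V), G.IsGeodesicPath l α → G.IsGeodesicPath l β →
      G.dist (α 0) (β 0) + G.dist (α l) (β l) ≤ 1 →
      (((Finset.range (l + 1)).filter (fun i => x < G.dist (α i) (β i))).card : ℝ) ≤ ε * l)
    (k : ℕ) {l l' T : ℕ} {α β : ℕ → V} (hα : G.IsGeodesicPath l α) (hβ : G.IsGeodesicPath l' β)
    (h0 : α 0 = β 0) (h1 : G.dist (α l) (β l') ≤ k) (hT : T + k ≤ l) (hT' : T + k ≤ l') :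
    (((Finset.range (T + 1)).filter (fun i => (k + 1) * x < G.dist (α i) (β i))).card : ℝ)
      ≤ (k + 1) * (ε * (l + k + 1)) := by
  induction k generalizing l α with
  | zero =>
    have := exists_card_le_of_dist_le_one hG hε hx hα hβ h0 (by omega) hT hT'
    simpa using this
  | succ k ih =>
    -- The end moves one vertex at a time and the losses add up; the margin `k` keeps every
    -- intermediate geodesic defined up to `T`.
    obtain ⟨p, hp1, hp2⟩ := exists_dist_le_dist_le hG (u := α l) (v := β l') (a := 1) (b := k) (by omega)
    obtain ⟨γ, hγ, g0, g1⟩ := exists_isGeodesicPath hG (α 0) p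
    have t1 := hG.dist_triangle (u := α 0) (v := α l) (w := p)
    have t2 := hG.dist_triangle (u := α 0) (v := p) (w := α l)
    rw [dist_comm (u := p)] at t2
    rw [hα.2] at t1 t2
    have c1 := exists_card_le_of_dist_le_one hG hε hx (T := T) hα hγ g0.symm (by rwa [g1])
      (by omega) (by omega)
    have c2 := ih hγ (g0.trans h0) (by rwa [g1]) (by omega) (by omega)
    have c3 : ((Finset.range (T + 1)).filter
        (fun i => (k + 1 + 1) * x < G.dist (α i) (β i))).card ≤
        ((Finset.range (T + 1)).filter (fun i => x < G.dist (α i) (γ i))).card +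
        ((Finset.range (T + 1)).filter (fun i => (k + 1) * x < G.dist (γ i) (β i))).card := by
      refine le_trans (Finset.card_le_card fun i hi => ?_) (Finset.card_union_le _ _)
      simp only [Finset.mem_union, Finset.mem_filter] at hi ⊢
      have t := hG.dist_triangle (u := α i) (v := γ i) (w := β i)
      by_contra hcon
      push Not at hcon
      have := hcon.1 hi.1
      have := hcon.2 hi.1
      have := hi.2
      linarith
    have c3' : (((Finset.range (T + 1)).filter
        (fun i => (k + 1 + 1) * x < G.dist (α i) (β i))).card : ℝ) ≤ _ := Nat.cast_le.2 c3
    refine c3'.trans ?_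
    push_cast
    have hl : (G.dist (α 0) p : ℝ) ≤ l + 1 := by exact_mod_cast t1.trans (by omega)
    have h2 : ((k : ℝ) + 1) * (ε * (G.dist (α 0) p + k + 1)) ≤
        (k + 1) * (ε * (l + (k + 1) + 1)) := by
      refine mul_le_mul_of_nonneg_left (mul_le_mul_of_nonneg_left ?_ hε.le) (by positivity)
      linarith
    have h3 : ε * ((l : ℝ) + 1) ≤ ε * (l + (k + 1) + 1) := by
      gcongr; have : (0 : ℝ) ≤ k := Nat.cast_nonneg k
      linarith
    linarith

end SimpleGraph

/-! ### Triadic pigeonhole -/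

/-- If no interval `[i, i + 3 m]` takes the same value as its outer thirds, then the interval
function `f` grows on average by a definite amount at each triadic subdivision. -/
theorem triadic_growth (f : ℕ → ℕ → ℕ) (Y U A B : ℕ)
    (hf : ∀ a a' b' b, a ≤ a' → a' ≤ b' → b' ≤ b → b ≤ B → f a b ≤ f a' b')
    (hno : ∀ i m, A ≤ i → U ≤ m → i + 3 * m ≤ B → f i (i + 3 * m) ≤ Y → f i (i + m) = f i (i + 3 * m) →
      f (i + 2 * m) (i + 3 * m) ≠ f i (i + 3 * m)) (R a : ℕ) (hA : A ≤ a) (hB : a + 3 ^ R * U ≤ B) :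
    3 * (3 ^ R * U) * min (f a (a + 3 ^ R * U)) (Y + 1) +
      R * ((Finset.Ico a (a + 3 ^ R * U)).filter (fun t => f t t ≤ Y)).card ≤
      3 * (3 ^ R * U) * (Y + 1) := by
  induction R generalizing a with
  | zero =>
    rw [zero_mul, add_zero]
    exact Nat.mul_le_mul_left _ (min_le_right _ _)
  | succ R ih =>
    have e3 : 3 ^ (R + 1) * U = 3 * (3 ^ R * U) := by ring
    have hm : U ≤ 3 ^ R * U := Nat.le_mul_of_pos_left U (by positivity)
    rw [e3] at hB ⊢
    generalize 3 ^ R * U = m at *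
    have i1 := ih a hA (by omega)
    have i2 := ih (a + m) (by omega) (by omega)
    have i3 := ih (a + 2 * m) (by omega) (by omega)
    rw [show a + m + m = a + 2 * m by ring] at i2
    rw [show a + 2 * m + m = a + 3 * m by ring] at i3
    have m1 := hf a a (a + m) (a + 3 * m) (by omega) (by omega) (by omega) (by omega)
    have m2 := hf a (a + m) (a + 2 * m) (a + 3 * m) (by omega) (by omega) (by omega) (by omega)
    have m3 := hf a (a + 2 * m) (a + 3 * m) (a + 3 * m) (by omega) (by omega) (by omega) (by omega)
    have hc : ((Finset.Ico a (a + 3 * m)).filter (fun t => f t t ≤ Y)).card ≤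
        ((Finset.Ico a (a + m)).filter (fun t => f t t ≤ Y)).card +
        ((Finset.Ico (a + m) (a + 2 * m)).filter (fun t => f t t ≤ Y)).card +
        ((Finset.Ico (a + 2 * m) (a + 3 * m)).filter (fun t => f t t ≤ Y)).card := by
      rw [← Finset.Ico_union_Ico_eq_Ico (show a ≤ a + 2 * m by omega) (by omega),
        ← Finset.Ico_union_Ico_eq_Ico (show a ≤ a + m by omega) (by omega),
        Finset.filter_union, Finset.filter_union]
      exact (Finset.card_union_le _ _).trans (Nat.add_le_add_right (Finset.card_union_le _ _) _)
    have hc' : ((Finset.Ico a (a + 3 * m)).filter (fun t => f t t ≤ Y)).card ≤ 3 * m :=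
      (Finset.card_filter_le _ _).trans (by simp)
    by_cases hY : f a (a + 3 * m) ≤ Y
    · have hn := hno a m hA hm hB hY
      -- Each third has at least the value of the whole and an outer one has more; since that value
      -- is at most `Y`, truncation at `Y + 1` keeps the gain. The factor `3 * m` then pays for all
      -- the good points.
      have hg : 3 * min (f a (a + 3 * m)) (Y + 1) + 1 ≤ min (f a (a + m)) (Y + 1) +
          min (f (a + m) (a + 2 * m)) (Y + 1) + min (f (a + 2 * m) (a + 3 * m)) (Y + 1) := by
        by_cases h1 : f a (a + m) = f a (a + 3 * m)
        · have := hn h1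
          omega
        · omega
      have hg' := Nat.mul_le_mul_left (3 * m) hg
      have hR := Nat.mul_le_mul_left R hc
      linarith
    · have h0 : (Finset.Ico a (a + 3 * m)).filter (fun t => f t t ≤ Y) = ∅ := by
        refine Finset.filter_eq_empty_iff.2 fun t ht => ?_
        rw [Finset.mem_Ico] at ht
        have := hf a t t (a + 3 * m) (by omega) (by omega) (by omega) (by omega)
        omega
      rw [h0, min_eq_right (by omega)]
      simp

/-- Otherwise each of the 6(Y + 1) levels raises the truncated average by a third of the density of
good points. With density above 1/2 the total gain would exceed Y + 1. -/
theorem exists_stable_interval (f : ℕ → ℕ → ℕ) (Y U a : ℕ)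
    (hf : ∀ b b' c' c, b ≤ b' → b' ≤ c' → c' ≤ c → c ≤ a + 3 ^ (6 * (Y + 1)) * U →
      f b c ≤ f b' c')
    (h : 3 ^ (6 * (Y + 1)) * U <
      2 * ((Finset.Ico a (a + 3 ^ (6 * (Y + 1)) * U)).filter (fun t => f t t ≤ Y)).card) :
    ∃ i m, a ≤ i ∧ U ≤ m ∧ i + 3 * m ≤ a + 3 ^ (6 * (Y + 1)) * U ∧ f i (i + 3 * m) ≤ Y ∧
      f i (i + m) = f i (i + 3 * m) ∧ f (i + 2 * m) (i + 3 * m) = f i (i + 3 * m) := by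
  by_contra hcon
  push Not at hcon
  have := triadic_growth f Y U a _ hf hcon (6 * (Y + 1)) a le_rfl le_rfl
  have h2 : 3 * (Y + 1) *
      (2 * ((Finset.Ico a (a + 3 ^ (6 * (Y + 1)) * U)).filter (fun t => f t t ≤ Y)).card) ≤
      3 * (Y + 1) * (3 ^ (6 * (Y + 1)) * U) := by
    have h3 := (Nat.le_add_left _ _).trans this
    linarith
  exact absurd (Nat.le_of_mul_le_mul_left h2 (by positivity)) (not_le.2 h)

/-! ### Close times and uniformly thin bigons -/

namespace SimpleGraph

variable {V : Type*} {G : SimpleGraph V}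

theorem exists_dist_le_two_mul (hG : G.Connected) {x : ℕ}
    (hx : ∀ (l : ℕ) (α β : ℕ → V), G.IsGeodesicPath l α → G.IsGeodesicPath l β →
      G.dist (α 0) (β 0) + G.dist (α l) (β l) ≤ 1 →
      (((Finset.range (l + 1)).filter (fun i => x < G.dist (α i) (β i))).card : ℝ) ≤ 1 / 8 * l)
    {Y U a l : ℕ} {α β : ℕ → V} (hU : 2 * Y + 1 ≤ U) (hα : G.IsGeodesicPath l α)
    (hβ : G.IsGeodesicPath l β) (h0 : α 0 = β 0) (hl : a + 3 ^ (6 * (Y + 1)) * U ≤ l)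
    (h : 3 ^ (6 * (Y + 1)) * U < 2 * ((Finset.Ico a (a + 3 ^ (6 * (Y + 1)) * U)).filter
      (fun t => G.dist (α t) (β t) ≤ Y)).card) :
    ∃ t, a < t ∧ t < a + 3 ^ (6 * (Y + 1)) * U ∧ G.dist (α t) (β t) ≤ 2 * x := by
  -- Nonnegativity of the excess, which makes the truncated subtractions below exact.
  have hpos : ∀ s t, s ≤ l → t ≤ l → t ≤ G.dist (α s) (β t) + s := by
    intro s t hs ht
    have e1 := hα.dist_eq hG (Nat.zero_le s) hs
    have e2 := hβ.dist_eq hG (Nat.zero_le t) ht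
    have t1 := hG.dist_triangle (u := α 0) (v := α s) (w := β t)
    rw [h0] at t1 e1
    omega
  obtain ⟨i, m, hi, hm, hB, hY, e1, e2⟩ :=
    exists_stable_interval (fun s t => G.dist (α s) (β t) + s - t) Y U a (by
      intro b b' c' c h1 h2 h3 h4
      have e1 := hα.dist_eq hG h1 (by omega)
      have e2 := hβ.dist_eq hG h3 (by omega)
      have t1 := hG.dist_triangle (u := α b) (v := α b') (w := β c)
      have t2 := hG.dist_triangle (u := α b') (v := β c') (w := β c)
      omega) (by simpa using h)
  have p1 := hpos i (i + m) (by omega) (by omega)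
  have p2 := hpos (i + 2 * m) (i + 3 * m) (by omega) (by omega)
  have p3 := hpos i (i + 3 * m) (by omega) (by omega)
  obtain ⟨k, hk⟩ : ∃ k, G.dist (α i) (β (i + 3 * m)) + i - (i + 3 * m) = k := ⟨_, rfl⟩
  rw [hk] at e1 e2 hY
  obtain ⟨γ, hγ, g0, g1⟩ := exists_isGeodesicPath hG (α i) (β (i + m))
  obtain ⟨γ', hγ', g0', g1'⟩ := exists_isGeodesicPath hG (α (i + 2 * m)) (β (i + 3 * m))
  rw [show G.dist (α i) (β (i + m)) = m + k by omega] at hγ g1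
  rw [show G.dist (α (i + 2 * m)) (β (i + 3 * m)) = m + k by omega] at hγ' g1'
  -- Both concatenations join `α i` to `β (i + 3 * m)` and have length `3 * m + k`, the distance of
  -- these points, because the three excesses agree.
  have s1 := hγ.concat hG (hβ.shift hG (a := i + m) (m := 2 * m) (by omega)) (by simpa using g1)
    (by rw [g0, show i + m + 2 * m = i + 3 * m by ring]; omega)
  have s2 := (hα.shift hG (a := i) (m := 2 * m) (by omega)).concat hG hγ' g0'.symm
    (by rw [g1', add_zero]; omega)
  rw [show m + k + 2 * m = 3 * m + k by ring] at s1
  rw [show 2 * m + (m + k) = 3 * m + k by ring] at s2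
  have key := hx _ _ _ s2 s1 (by
    simp only [Nat.zero_le, if_true, add_zero, g0, dist_self, zero_add]
    rw [if_neg (by omega), if_neg (by omega), show 3 * m + k - 2 * m = m + k by omega, g1',
      show i + m + (3 * m + k - (m + k)) = i + 3 * m by omega]
    simp)
  -- In this window one path follows α and the other β delayed by `k`. As 2k < m, its m - k times
  -- are more than 1/8 of 3m + k.
  obtain ⟨t, ht1, ht2, ht⟩ : ∃ t, m + k < t ∧ t ≤ 2 * m ∧
      G.dist (α (i + t)) (β (i + t - k)) ≤ x := by
    by_contra hcon
    push Not at hcon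
    have hc : ((Finset.Ioc (m + k) (2 * m)).card : ℝ) ≤ 1 / 8 * ((3 * m + k : ℕ) : ℝ) := by
      refine le_trans (Nat.cast_le.2 (Finset.card_le_card fun t ht => ?_)) key
      rw [Finset.mem_Ioc] at ht
      refine Finset.mem_filter.2 ⟨Finset.mem_range.2 (by omega), ?_⟩
      have := hcon t ht.1 ht.2
      rw [if_pos ht.2, if_neg (by omega), show i + m + (t - (m + k)) = i + t - k by omega]
      exact this
    rw [Nat.card_Ioc] at hc
    have h1 : 8 * (2 * m - (m + k)) ≤ 3 * m + k := by
      have h2 : (8 : ℝ) * ((2 * m - (m + k) : ℕ) : ℝ) ≤ ((3 * m + k : ℕ) : ℝ) := by linarith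
      exact_mod_cast h2
    omega
  refine ⟨i + t, by omega, by omega, ?_⟩
  -- Comparing distances to the origin gives k ≤ x, so undoing the delay costs at most another x.
  have e3 := hβ.dist_eq hG (i := i + t - k) (j := i + t) (by omega) (by omega)
  have e4 := hβ.dist_eq hG (i := 0) (j := i + t - k) (by omega) (by omega)
  have e5 := hα.dist_eq hG (i := 0) (j := i + t) (by omega) (by omega)
  have t1 := hG.dist_triangle (u := α (i + t)) (v := β (i + t - k)) (w := β (i + t))
  have t2 := hG.dist_triangle (u := α 0) (v := β (i + t - k)) (w := α (i + t))
  rw [dist_comm (u := β (i + t - k))] at t2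
  rw [← h0] at e4
  omega

/-- Almost sure thinness for geodesic quadrilaterals with two short opposite sides. -/
theorem exists_card_quadrilateral_le (hG : G.Connected) (hT : G.ThinAlmostSurely) (X : ℕ) :
    ∃ Y : ℕ, ∀ (a m l : ℕ) (α β : ℕ → V), G.IsGeodesicPath l α → G.IsGeodesicPath l β →
      a + m ≤ l → 2 * X ≤ m → G.dist (α a) (β a) ≤ X → G.dist (α (a + m)) (β (a + m)) ≤ X →
      4 * ((Finset.Ico a (a + m)).filter (fun t => Y < G.dist (α t) (β t))).card ≤
        m + 17 * X + 1 := by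
  have hε : (0 : ℝ) < 1 / (8 * (X + 1)) := by positivity
  obtain ⟨x, hx⟩ := hT.exists_card_le hε
  refine ⟨2 * ((X + 1) * x) + X, fun a m l α β hα hβ hl hm ha hb => ?_⟩
  -- The diagonal γ is compared with α from their common start and with β, reversed, from their
  -- common end. The two parametrizations of γ differ by at most `X`.
  obtain ⟨γ, hγ, g0, g1⟩ := exists_isGeodesicPath hG (α a) (β (a + m))
  obtain ⟨n, hn⟩ : ∃ n, G.dist (α a) (β (a + m)) = n := ⟨_, rfl⟩
  rw [hn] at hγ g1
  have e1 := hα.dist_eq hG (i := a) (j := a + m) (by omega) hl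
  have t1 := hG.dist_triangle (u := α a) (v := α (a + m)) (w := β (a + m))
  have t2 := hG.dist_triangle (u := α a) (v := β (a + m)) (w := α (a + m))
  rw [dist_comm (u := β (a + m))] at t2
  obtain ⟨T, rfl⟩ := Nat.exists_eq_add_of_le' hm
  have c1 := exists_card_le_of_dist_le hG hε hx X (T := T) (hα.shift hG hl) hγ (by simp [g0])
    (by rwa [g1]) (by omega) (by omega)
  have c2 := exists_card_le_of_dist_le hG hε hx X (T := T) ((hβ.shift hG hl).reverse hG)
    (hγ.reverse hG) (by simp [g1]) (by simpa [g0, dist_comm] using ha) (by omega) (by omega)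
  have hsub : (Finset.Ico a (a + (T + 2 * X))).filter
      (fun t => 2 * ((X + 1) * x) + X < G.dist (α t) (β t)) ⊆
      ((((Finset.range (T + 1)).filter
          (fun i => (X + 1) * x < G.dist (α (a + i)) (γ i))).image (fun i => a + i)) ∪
        (((Finset.range (T + 1)).filter (fun i => (X + 1) * x <
          G.dist (β (a + (T + 2 * X - i))) (γ (n - i)))).image
            (fun i => a + (T + 2 * X - i)))) ∪
      (Finset.Ico a (a + 2 * X) ∪ Finset.Ico (a + T) (a + (T + 2 * X))) := by
    intro t ht
    simp only [Finset.mem_filter, Finset.mem_Ico] at ht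
    obtain ⟨⟨h1, h2⟩, h3⟩ := ht
    obtain ⟨s, rfl⟩ := Nat.exists_eq_add_of_le h1
    by_contra hcon
    simp only [Finset.mem_union, Finset.mem_image, Finset.mem_filter, Finset.mem_range,
      Finset.mem_Ico, not_or, not_exists, not_and] at hcon
    obtain ⟨⟨k1, k2⟩, k3, k4⟩ := hcon
    have d1 : ¬ (X + 1) * x < G.dist (α (a + s)) (γ s) := fun h => k1 s ⟨by omega, h⟩ rfl
    have hs : T + 2 * X - (T + 2 * X - s) = s := by omega
    have d2 : ¬ (X + 1) * x < G.dist (β (a + s)) (γ (n - (T + 2 * X - s))) := fun h =>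
      k2 (T + 2 * X - s) ⟨by omega, by rwa [hs]⟩ (by rw [hs])
    have d3 := hγ.1 s (by omega) (n - (T + 2 * X - s)) (by omega)
    have d4 : Nat.dist s (n - (T + 2 * X - s)) ≤ X := by simp only [Nat.dist]; omega
    have u1 := hG.dist_triangle (u := α (a + s)) (v := γ s) (w := β (a + s))
    have u2 := hG.dist_triangle (u := γ s) (v := γ (n - (T + 2 * X - s))) (w := β (a + s))
    rw [dist_comm (v := β (a + s)) (u := γ (n - (T + 2 * X - s)))] at u2
    omega
  -- Two sets of at most (m + X + 1)/8 bad times, plus 2X times lost at each end, where m = T + 2X.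
  have hcard := (Finset.card_le_card hsub).trans ((Finset.card_union_le _ _).trans
    (Nat.add_le_add ((Finset.card_union_le _ _).trans
      (Nat.add_le_add Finset.card_image_le Finset.card_image_le)) (Finset.card_union_le _ _)))
  rw [Nat.card_Ico, Nat.card_Ico, Nat.add_sub_cancel_left,
    show a + (T + 2 * X) - (a + T) = 2 * X by omega] at hcard
  have hbound : ((X : ℝ) + 1) * (1 / (8 * (X + 1)) * (((T + 2 * X : ℕ) : ℝ) + X + 1)) =
      (((T + 2 * X : ℕ) : ℝ) + X + 1) / 8 := by
    field_simp
  rw [hbound] at c1 c2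
  rw [← Nat.cast_le (α := ℝ)] at hcard ⊢
  push_cast at hcard c1 c2 ⊢
  have hX : (0 : ℝ) ≤ X := Nat.cast_nonneg X
  linarith

/-- Bigons are uniformly thin. -/
theorem exists_dist_le_of_dist_le_one (hG : G.Connected) (hT : G.ThinAlmostSurely) :
    ∃ C : ℕ, ∀ (l l' t : ℕ) (α β : ℕ → V), G.IsGeodesicPath l α → G.IsGeodesicPath l' β →
      α 0 = β 0 → G.dist (α l) (β l') ≤ 1 → t ≤ l → t ≤ l' → G.dist (α t) (β t) ≤ C := by
  obtain ⟨x, hx⟩ := hT.exists_card_le (ε := 1 / 8) (by norm_num)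
  -- 2x covers the close times found below; 2 covers the initial ends after cutting to equal length.
  obtain ⟨X, hX⟩ : ∃ X, X = 2 * x + 2 := ⟨_, rfl⟩
  obtain ⟨Y, hY⟩ := exists_card_quadrilateral_le hG hT X
  obtain ⟨Q, hQ⟩ : ∃ Q, Q = 3 ^ (6 * (Y + 1)) := ⟨_, rfl⟩
  have hQ0 : 0 < Q := hQ ▸ by positivity
  -- From this length on, the bad times fill less than half of the window `Q * U`; below it the
  -- speed bound 2 suffices.
  obtain ⟨M, hM⟩ : ∃ M, M = Q * (2 * Y + 17 * X + 3) := ⟨_, rfl⟩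
  have key : ∀ (l : ℕ) (α β : ℕ → V), G.IsGeodesicPath l α → G.IsGeodesicPath l β →
      α 0 = β 0 → ∀ m a, a + m ≤ l → G.dist (α a) (β a) ≤ X →
      G.dist (α (a + m)) (β (a + m)) ≤ X → ∀ t, a ≤ t → t ≤ a + m →
      G.dist (α t) (β t) ≤ X + 2 * M := by
    intro l α β hα hβ h0 m
    induction m using Nat.strong_induction_on with
    | _ m ih =>
    intro a hl ha hb t hat htb
    by_cases hm : m < M
    · have := hα.dist_le_add hG hβ (i := a) (j := t) (by omega) (by omega)
      simp only [Nat.dist] at this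
      omega
    · obtain ⟨U, hU⟩ : ∃ U, U = m / Q := ⟨_, rfl⟩
      have hU1 : 2 * Y + 17 * X + 3 ≤ U := by
        rw [hU, Nat.le_div_iff_mul_le hQ0, mul_comm]; omega
      have hU2 : Q * U ≤ m := hU ▸ Nat.mul_div_le m Q
      have hU3 : m < Q * U + Q := by
        have := Nat.lt_mul_div_succ m hQ0
        rwa [← hU, mul_add, mul_one] at this
      have hU4 : Q + (17 * X + 2) ≤ Q * U := by nlinarith
      have hU5 : U ≤ Q * U := Nat.le_mul_of_pos_left U hQ0
      have hbad := hY a m l α β hα hβ hl (by omega) ha hb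
      have hsub : ((Finset.Ico a (a + Q * U)).filter (fun t => ¬ G.dist (α t) (β t) ≤ Y)).card ≤
          ((Finset.Ico a (a + m)).filter (fun t => Y < G.dist (α t) (β t))).card := by
        refine Finset.card_le_card fun i hi => ?_
        simp only [Finset.mem_filter, Finset.mem_Ico, not_le] at hi ⊢
        exact ⟨by omega, hi.2⟩
      have hsum := Finset.card_filter_add_card_filter_not (s := Finset.Ico a (a + Q * U))
        (fun t => G.dist (α t) (β t) ≤ Y)
      rw [Nat.card_Ico] at hsum
      obtain ⟨s, hs1, hs2, hs⟩ := exists_dist_le_two_mul hG hx (Y := Y) (U := U) (a := a)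
        (by omega) hα hβ h0 (by rw [← hQ]; omega) (by rw [← hQ]; omega)
      rw [← hQ] at hs2
      rcases le_total t s with hts | hts
      · exact ih (s - a) (by omega) a (by omega) ha
          (by rw [show a + (s - a) = s by omega]; omega) t hat (by omega)
      · exact ih (a + m - s) (by omega) s (by omega) (by omega)
          (by rwa [show s + (a + m - s) = a + m by omega]) t hts (by omega)
  refine ⟨X + 2 * M, fun l l' t α β hα hβ h0 h1 ht ht' => ?_⟩
  refine key (min l l') α β (hα.mono hG (min_le_left _ _)) (hβ.mono hG (min_le_right _ _)) h0
    (min l l') 0 (by omega) (by simp [h0]) ?_ t (by omega) (by omega)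
  have e1 := hα.dist_eq hG (min_le_left l l') le_rfl
  have e2 := hβ.dist_eq hG (min_le_right l l') le_rfl
  have e3 := hα.2
  have e4 := hβ.2
  have t1 := hG.dist_triangle (u := α (min l l')) (v := α l) (w := β (min l l'))
  have t2 := hG.dist_triangle (u := α l) (v := β l') (w := β (min l l'))
  have t3 := hG.dist_triangle (u := α 0) (v := α l) (w := β l')
  have t4 := hG.dist_triangle (u := α 0) (v := β l') (w := α l)
  rw [dist_comm (u := β l')] at t2 t4
  rw [← h0] at e4
  rw [zero_add]
  omega

/-! ### Backward contraction -/

theorem dist_le_of_dist_ends_le (hG : G.Connected) {C : ℕ}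
    (hC : ∀ (l l' t : ℕ) (α β : ℕ → V), G.IsGeodesicPath l α → G.IsGeodesicPath l' β →
      α 0 = β 0 → G.dist (α l) (β l') ≤ 1 → t ≤ l → t ≤ l' → G.dist (α t) (β t) ≤ C)
    (k : ℕ) {l l' t : ℕ} {α β : ℕ → V} (hα : G.IsGeodesicPath l α) (hβ : G.IsGeodesicPath l' β)
    (h0 : α 0 = β 0) (h1 : G.dist (α l) (β l') ≤ k) (ht : t + k ≤ l) (ht' : t + k ≤ l') :
    G.dist (α t) (β t) ≤ (k + 1) * C := by
  induction k generalizing l α with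
  | zero =>
    have := hC l l' t α β hα hβ h0 (by omega) ht ht'
    simpa using this
  | succ k ih =>
    obtain ⟨p, hp1, hp2⟩ := exists_dist_le_dist_le hG (u := α l) (v := β l') (a := 1) (b := k)
      (by omega)
    obtain ⟨γ, hγ, g0, g1⟩ := exists_isGeodesicPath hG (α 0) p
    have t2 := hG.dist_triangle (u := α 0) (v := p) (w := α l)
    rw [dist_comm (u := p), hα.2] at t2
    have c1 := hC l _ t α γ hα hγ g0.symm (by rwa [g1]) (by omega) (by omega)
    have c2 := ih hγ (g0.trans h0) (by rwa [g1]) (by omega) (by omega)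
    have t := hG.dist_triangle (u := α t) (v := γ t) (w := β t)
    linarith

/-- Backward contraction of pairs of geodesics with a common origin. -/
theorem exists_contraction (hG : G.Connected) (hT : G.ThinAlmostSurely) {C : ℕ}
    (hC : ∀ (l l' t : ℕ) (α β : ℕ → V), G.IsGeodesicPath l α → G.IsGeodesicPath l' β →
      α 0 = β 0 → G.dist (α l) (β l') ≤ 1 → t ≤ l → t ≤ l' → G.dist (α t) (β t) ≤ C) :
    ∃ K L : ℕ, C ≤ 2 * K ∧ 1 ≤ L ∧ ∀ (t : ℕ) (α β : ℕ → V), G.IsGeodesicPath (t + L) α →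
      G.IsGeodesicPath (t + L) β → α 0 = β 0 → G.dist (α (t + L)) (β (t + L)) ≤ 2 * K →
      G.dist (α t) (β t) ≤ K := by
  obtain ⟨x, hx⟩ := hT.exists_card_le (ε := 1 / 8) (by norm_num)
  -- `K` depends only on x and C. The a priori bound `Y` for ends 2K apart affects only `L`, the
  -- length of a window with its margins.
  obtain ⟨K, hK⟩ : ∃ K, K = (2 * x + 1) * C := ⟨_, rfl⟩
  obtain ⟨Y, hY⟩ : ∃ Y, Y = (2 * K + 1) * C := ⟨_, rfl⟩
  obtain ⟨P, hP⟩ : ∃ P, P = 3 ^ (6 * (Y + 1)) * (2 * Y + 1) := ⟨_, rfl⟩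
  have hP0 : 0 < P := hP ▸ by positivity
  refine ⟨K, 2 * x + P + 2 * K, by nlinarith, by omega, fun t α β hα hβ h0 h => ?_⟩
  obtain ⟨s, hs1, hs2, hs⟩ := exists_dist_le_two_mul hG hx (Y := Y) (U := 2 * Y + 1)
    (a := t + 2 * x) le_rfl hα hβ h0 (by omega) (by
      rw [← hP, Finset.filter_true_of_mem, Nat.card_Ico]
      · omega
      · intro s hs
        rw [Finset.mem_Ico] at hs
        rw [hY]
        exact dist_le_of_dist_ends_le hG hC (2 * K) hα hβ h0 h (by omega) (by omega))
  rw [hK]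
  rw [← hP] at hs2
  exact dist_le_of_dist_ends_le hG hC (2 * x) (hα.mono hG (m := s) (by omega))
    (hβ.mono hG (by omega)) h0 hs (by omega) (by omega)

/-! ### Chains of geodesics -/

/-- The geodesics `α` and `β` issuing from `o` are joined by a chain of `m + 1` geodesics issuing
from `o`, all of length at least `s`, whose consecutive members are at distance at most `D` at
time `s`. -/
def GeodesicChain (G : SimpleGraph V) (o : V) (D s m : ℕ) (α β : ℕ → V) : Prop :=
  ∃ c : ℕ → ℕ → V, c 0 = α ∧ c m = β ∧ (∀ i ≤ m, G.IsGeodesicPath s (c i) ∧ c i 0 = o) ∧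
    ∀ i < m, G.dist (c i s) (c (i + 1) s) ≤ D

namespace GeodesicChain

variable {o : V} {D s m : ℕ} {α β γ : ℕ → V}

theorem refl (hα : G.IsGeodesicPath s α) (h0 : α 0 = o) : G.GeodesicChain o D s 0 α α :=
  ⟨fun _ => α, rfl, rfl, fun _ _ => ⟨hα, h0⟩, fun i hi => absurd hi (Nat.not_lt_zero i)⟩

theorem snoc (h : G.GeodesicChain o D s m α β) (hγ : G.IsGeodesicPath s γ) (h0 : γ 0 = o)
    (hd : G.dist (β s) (γ s) ≤ D) : G.GeodesicChain o D s (m + 1) α γ := by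
  obtain ⟨c, c0, c1, c2, c3⟩ := h
  refine ⟨fun i => if i ≤ m then c i else γ, by simpa using c0, by simp, fun i hi => ?_,
    fun i hi => ?_⟩
  · dsimp only
    split_ifs with h
    · exact c2 i h
    · exact ⟨hγ, h0⟩
  · dsimp only
    rw [if_pos (show i ≤ m by omega)]
    split_ifs with h
    · exact c3 i (by omega)
    · obtain rfl : i = m := by omega
      rwa [c1]

theorem mono (h : G.GeodesicChain o D s m α β) {m' : ℕ} (hm : m ≤ m') :
    G.GeodesicChain o D s m' α β := by
  obtain ⟨c, c0, c1, c2, c3⟩ := h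
  refine ⟨fun i => c (min i m), by simpa using c0, by simpa [hm] using c1,
    fun i _ => c2 _ (min_le_right _ _), fun i _ => ?_⟩
  dsimp only
  rcases lt_or_ge i m with h | h
  · rw [min_eq_left h.le, min_eq_left (by omega)]
    exact c3 i h
  · rw [min_eq_right h, min_eq_right (by omega)]
    simp

theorem dist_le (hG : G.Connected) (h : G.GeodesicChain o D s m α β) :
    G.dist (α s) (β s) ≤ m * D := by
  obtain ⟨c, rfl, rfl, c2, c3⟩ := h
  have : ∀ i ≤ m, G.dist (c 0 s) (c i s) ≤ i * D := by
    intro i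
    induction i with
    | zero => simp
    | succ i ih =>
      intro hi
      have h1 := ih (by omega)
      have h2 := c3 i hi
      have t := hG.dist_triangle (u := c 0 s) (v := c i s) (w := c (i + 1) s)
      linarith
  exact this m le_rfl

/-- Chains become twice as short when going back to the origin. -/
theorem halve (hG : G.Connected) {K L : ℕ}
    (hL : ∀ (t : ℕ) (α β : ℕ → V), G.IsGeodesicPath (t + L) α →
      G.IsGeodesicPath (t + L) β → α 0 = β 0 → G.dist (α (t + L)) (β (t + L)) ≤ 2 * K →
      G.dist (α t) (β t) ≤ K)
    (h : G.GeodesicChain o (2 * K) (s + L) (2 * m) α β) : G.GeodesicChain o (2 * K) s m α β := by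
  obtain ⟨c, c0, c1, c2, c3⟩ := h
  refine ⟨fun i => c (2 * i), c0, c1, fun i hi => ?_, fun i hi => ?_⟩
  · have := c2 (2 * i) (by omega)
    exact ⟨this.1.mono hG (by omega), this.2⟩
  · have a0 := c2 (2 * i) (by omega)
    have a1 := c2 (2 * i + 1) (by omega)
    have a2 := c2 (2 * i + 1 + 1) (by omega)
    have b0 := hL s _ _ a0.1 a1.1 (a0.2.trans a1.2.symm) (c3 (2 * i) (by omega))
    have b1 := hL s _ _ a1.1 a2.1 (a1.2.trans a2.2.symm) (c3 (2 * i + 1) (by omega))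
    have t := hG.dist_triangle (u := c (2 * i) s) (v := c (2 * i + 1) s)
      (w := c (2 * i + 1 + 1) s)
    have e : 2 * (i + 1) = 2 * i + 1 + 1 := by ring
    dsimp only
    rw [e]
    omega

/-- Moving the end of the last geodesic by `k` adds at most `k` steps to a chain. -/
theorem append_of_dist_le (hG : G.Connected) {C : ℕ} (hCD : C ≤ D)
    (hC : ∀ (l l' t : ℕ) (α β : ℕ → V), G.IsGeodesicPath l α → G.IsGeodesicPath l' β →
      α 0 = β 0 → G.dist (α l) (β l') ≤ 1 → t ≤ l → t ≤ l' → G.dist (α t) (β t) ≤ C)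
    (k : ℕ) {l l' : ℕ} (h : G.GeodesicChain o D s m α β) (hβ : G.IsGeodesicPath l β)
    (hβ0 : β 0 = o) (hγ : G.IsGeodesicPath l' γ) (hγ0 : γ 0 = o)
    (hd : G.dist (β l) (γ l') ≤ k + 1) (hk : s + (k + 1) ≤ l) :
    G.GeodesicChain o D s (m + (k + 1)) α γ := by
  have hl : ∀ {l l' : ℕ} {β γ : ℕ → V}, G.IsGeodesicPath l β → G.IsGeodesicPath l' γ →
      β 0 = o → γ 0 = o → l ≤ l' + G.dist (β l) (γ l') := by
    intro l l' β γ hβ hγ hβ0 hγ0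
    have t := hG.dist_triangle (u := o) (v := γ l') (w := β l)
    have e1 := hβ.2
    have e2 := hγ.2
    rw [hβ0] at e1
    rw [hγ0] at e2
    rw [dist_comm (u := γ l')] at t
    omega
  induction k generalizing l β m with
  | zero =>
    have := hl hβ hγ hβ0 hγ0
    exact h.snoc (hγ.mono hG (by omega)) hγ0
      ((hC l l' s β γ hβ hγ (hβ0.trans hγ0.symm) (by omega) (by omega) (by omega)).trans hCD)
  | succ k ih =>
    obtain ⟨p, hp1, hp2⟩ := exists_dist_le_dist_le hG (u := β l) (v := γ l') (a := 1)
      (b := k + 1) (by omega)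
    obtain ⟨δ, hδ, d0, d1⟩ := exists_isGeodesicPath hG o p
    have hlδ := hl hβ hδ hβ0 d0
    rw [d1] at hlδ
    have h' := h.snoc (hδ.mono hG (m := s) (by omega)) d0 ((hC l _ s β δ hβ hδ
      (hβ0.trans d0.symm) (by rwa [d1]) (by omega) (by omega)).trans hCD)
    rw [show m + (k + 1 + 1) = m + 1 + (k + 1) by ring]
    exact ih h' hδ d0 (by rwa [d1]) (by omega)

end GeodesicChain

/-- A geodesic whose end is moved inside a ball which stays at distance `s` from the origin
moves by a bounded amount at time `s`. -/
theorem geodesicChain_of_add_le (hG : G.Connected) {C K L : ℕ} (hCK : C ≤ 2 * K) (hL1 : 1 ≤ L)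
    (hC : ∀ (l l' t : ℕ) (α β : ℕ → V), G.IsGeodesicPath l α → G.IsGeodesicPath l' β →
      α 0 = β 0 → G.dist (α l) (β l') ≤ 1 → t ≤ l → t ≤ l' → G.dist (α t) (β t) ≤ C)
    (hL : ∀ (t : ℕ) (α β : ℕ → V), G.IsGeodesicPath (t + L) α →
      G.IsGeodesicPath (t + L) β → α 0 = β 0 → G.dist (α (t + L)) (β (t + L)) ≤ 2 * K →
      G.dist (α t) (β t) ≤ K)
    (o : V) (N : ℕ) {s l l' : ℕ} {α β : ℕ → V} (hα : G.IsGeodesicPath l α) (hα0 : α 0 = o)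
    (hβ : G.IsGeodesicPath l' β) (hβ0 : β 0 = o) (hd : G.dist (α l) (β l') ≤ N)
    (hs : s + N ≤ l) : G.GeodesicChain o (2 * K) s (2 * L) α β := by
  induction N using Nat.strong_induction_on generalizing s l' β with
  | _ N ih =>
  rcases Nat.eq_zero_or_pos N with rfl | hN
  · have h := (GeodesicChain.refl (D := 2 * K) (hα.mono hG (m := s) (by omega)) hα0)
    have e : l' = l := by
      have e1 := hβ.2
      have e2 := hα.2
      rw [hβ0, ← (hG.dist_eq_zero_iff.1 (Nat.le_zero.1 hd)), ← hα0] at e1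
      omega
    exact (h.snoc (hβ.mono hG (by omega)) hβ0 ((hC l l' s α β hα hβ (hα0.trans hβ0.symm)
      (by omega) (by omega) (by omega)).trans hCK)).mono (by omega)
  rcases le_or_gt N L with hNL | hNL
  · obtain ⟨k, rfl⟩ := Nat.exists_eq_add_of_le' hN
    have h := (GeodesicChain.refl (D := 2 * K) (hα.mono hG (m := s) (by omega)) hα0)
    exact (h.append_of_dist_le hG hCK hC k hα hα0 hβ hβ0 hd (by omega)).mono (by omega)
  · obtain ⟨p, hp1, hp2⟩ := exists_dist_le_dist_le hG (u := α l) (v := β l') (a := N - L)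
      (b := L) (by omega)
    obtain ⟨δ, hδ, d0, d1⟩ := exists_isGeodesicPath hG o p
    have h := (ih (N - L) (by omega) (s := s + L) hδ d0 (by rwa [d1]) (by omega)).halve hG hL
    have t := hG.dist_triangle (u := o) (v := p) (w := α l)
    have e := hα.2
    rw [hα0] at e
    rw [dist_comm (u := p)] at t
    obtain ⟨k, rfl⟩ := Nat.exists_eq_add_of_le' hL1
    have := h.append_of_dist_le hG hCK hC k hδ d0 hβ hβ0 (by rwa [d1]) (by omega)
    exact this.mono (by omega)

/-- Geodesics with a common origin fellow-travel up to the Gromov product of their ends. -/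
theorem exists_dist_le_of_two_mul_le (hG : G.Connected) (hT : G.ThinAlmostSurely) :
    ∃ D : ℕ, ∀ (o : V) (s l l' : ℕ) (α β : ℕ → V), G.IsGeodesicPath l α → G.IsGeodesicPath l' β →
      α 0 = o → β 0 = o → s ≤ l → s ≤ l' → 2 * s + G.dist (α l) (β l') ≤ l + l' →
      G.dist (α s) (β s) ≤ D := by
  obtain ⟨C, hC⟩ := exists_dist_le_of_dist_le_one hG hT
  obtain ⟨K, L, hCK, hL1, hL⟩ := exists_contraction hG hT hC
  refine ⟨2 * (2 * L * (2 * K)), fun o s l l' α β hα hβ hα0 hβ0 hs hs' h => ?_⟩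
  -- Both ends can be moved to `p` within radii small enough for the displacement bound at time `s`.
  obtain ⟨p, hp1, hp2⟩ := exists_dist_le_dist_le hG (u := α l) (v := β l') (a := l - s)
    (b := l' - s) (by omega)
  obtain ⟨δ, hδ, d0, d1⟩ := exists_isGeodesicPath hG o p
  have h1 := (geodesicChain_of_add_le hG hCK hL1 hC hL o (l - s) hα hα0 hδ d0
    (by rwa [d1]) (show s + (l - s) ≤ l by omega)).dist_le hG
  have h2 := (geodesicChain_of_add_le hG hCK hL1 hC hL o (l' - s) hβ hβ0 hδ d0
    (by rwa [d1, dist_comm]) (show s + (l' - s) ≤ l' by omega)).dist_le hG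
  have t := hG.dist_triangle (u := α s) (v := δ s) (w := β s)
  rw [dist_comm (u := δ s)] at t
  omega

end SimpleGraph

/-! ### Gromov hyperbolicity -/

theorem mainTheorem2 {V : Type*} (G : SimpleGraph V) (hG : G.Connected)
    (hTAS : G.ThinAlmostSurely) : G.IsGromovHyperbolic := by
  obtain ⟨D, hD⟩ := SimpleGraph.exists_dist_le_of_two_mul_le hG hTAS
  refine ⟨D + 1, by positivity, fun w x y z => ?_⟩
  obtain ⟨α, hα, a0, a1⟩ := SimpleGraph.exists_isGeodesicPath hG w x
  obtain ⟨β, hβ, b0, b1⟩ := SimpleGraph.exists_isGeodesicPath hG w y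
  obtain ⟨γ, hγ, c0, c1⟩ := SimpleGraph.exists_isGeodesicPath hG w z
  simp only [SimpleGraph.gromovProduct, G.dist_comm (v := w)]
  have e1 := hG.dist_triangle (u := w) (v := x) (w := y)
  have e2 := hG.dist_triangle (u := w) (v := y) (w := x)
  have e3 := hG.dist_triangle (u := w) (v := y) (w := z)
  have e4 := hG.dist_triangle (u := w) (v := z) (w := y)
  have e5 := hG.dist_triangle (u := x) (v := w) (w := y)
  have e6 := hG.dist_triangle (u := y) (v := w) (w := z)
  rw [G.dist_comm (u := y) (v := x)] at e2
  rw [G.dist_comm (u := z) (v := y)] at e4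
  rw [G.dist_comm (u := x) (v := w)] at e5
  rw [G.dist_comm (u := y) (v := w)] at e6
  -- The smaller Gromov product rounded down; the loss of at most 1/2 is absorbed by the 1 in `D +
  -- 1`.
  obtain ⟨s, hs⟩ : ∃ s, s = min ((G.dist w x + G.dist w y - G.dist x y) / 2)
    ((G.dist w y + G.dist w z - G.dist y z) / 2) := ⟨_, rfl⟩
  have h1 := hD w s _ _ α β hα hβ a0 b0 (by omega) (by omega) (by rw [a1, b1]; omega)
  have h2 := hD w s _ _ β γ hβ hγ b0 c0 (by omega) (by omega) (by rw [b1, c1]; omega)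
  have f1 := hα.dist_eq hG (i := s) (j := G.dist w x) (by omega) le_rfl
  have f2 := hγ.dist_eq hG (i := s) (j := G.dist w z) (by omega) le_rfl
  rw [a1, G.dist_comm] at f1
  rw [c1] at f2
  have t1 := hG.dist_triangle (u := x) (v := α s) (w := z)
  have t2 := hG.dist_triangle (u := α s) (v := β s) (w := z)
  have t3 := hG.dist_triangle (u := β s) (v := γ s) (w := z)
  have key : G.dist x z + 2 * s ≤ G.dist w x + G.dist w z + 2 * D := by omega
  have key' : (G.dist x z : ℝ) + 2 * s ≤ G.dist w x + G.dist w z + 2 * D := by exact_mod_cast key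
  rcases (show G.dist w x + G.dist w y ≤ G.dist x y + 2 * s + 1 ∨
      G.dist w y + G.dist w z ≤ G.dist y z + 2 * s + 1 by omega) with h | h
  · have h' : (G.dist w x : ℝ) + G.dist w y ≤ G.dist x y + 2 * s + 1 := by exact_mod_cast h
    refine (sub_le_sub_right (min_le_left _ _) _).trans ?_
    linarith
  · have h' : (G.dist w y : ℝ) + G.dist w z ≤ G.dist y z + 2 * s + 1 := by exact_mod_cast h
    refine (sub_le_sub_right (min_le_right _ _) _).trans ?_
    linarith
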